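/- Let $d\in\mathbb N$, $\gamma>1$, let $(\mathbf g_t)_{t\ge1}\subset\mathbb R^d$ be any sequence of (sub-)gradients and $(h_t)_{t\ge1}$ a sequence of real hints with $h_1>0$. Put \[ \rho(\gamma)=\frac1{2\gamma}\Bigl(\sqrt{(\gamma+1)^2-4e^{\frac1{2\gamma}-\frac12}\gamma^{3/2}}+\gamma-1\Bigr),\qquad \mathbf G_t=\sum_{s=1}^t\mathbf g_s,\qquad \mathbf V_t=\sum_{s=1}^t\mathbf g_s\mathbf g_s^\top, \] and define, for $\mathbf G\in\mathbb R^d$, $\mathbf V\in\mathbb R^{d\times d}$ and $h>0$, the potential \[ \Psi(\mathbf G,\mathbf V,h)=\frac{h_1\exp\Bigl(\inf_{\lambda\ge0}\bigl\{\tfrac12\mathbf G^\top(\gamma h_1^2\mathbf I+\gamma\mathbf V+\lambda\mathbf I)^{-1}\mathbf G+\tfrac{\lambda\rho(\gamma)^2}{2h^2}\bigr\}\Bigr)}{\sqrt{\det(\mathbf I+\mathbf V/h_1^2)}} . \] In round $t\ge1$, Matrix-FreeGrad predicts $\hat{\mathbf w}_t=-\nabla_{\mathbf G}\Psi(\mathbf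 G_{t-1},\mathbf V_{t-1},h_t)$. Write $\ln_+(x)=\max\{0,\ln x\}$, with $\ln_+(0)=0$ and $0\ln0=0$. (1) For every $t\ge1$ with $h_t>0$ the gradient defining $\hat{\mathbf w}_t$ exists, and if moreover $\|\mathbf g_t\|\le h_t$, then \[ \mathbf g_t^\top\hat{\mathbf w}_t\le\Psi(\mathbf G_{t-1},\mathbf V_{t-1},h_t)-\Psi(\mathbf G_t,\mathbf V_t,h_t). \] (2) Let $T\ge1$ and suppose that $h_1\le\dots\le h_T$ and $h_t\ge\max_{s\le t}\|\mathbf g_s\|$ for all $1\le t\le T$. With $\mathbf\Sigma_T^{-1}=\gamma h_1^2\mathbf I+\gamma\mathbf V_T$, for all $\mathbf w\in\mathbb R^d$, \[ \sum_{t=1}^T\langle\hat{\mathbf w}_t-\mathbf w,\mathbf g_t\rangle\le h_1+\sqrt{Q_T^{\mathbf w}\,\ln_+\Bigl(\frac{\det(\gamma h_1^2\mathbf\Sigma_T)^{-1}}{h_1^2}Q_T^{\mathbf w}\Bigr)}, \] \[ Q_T^{\mathbf w}=\max\Bigl\{\mathbf w^\top\mathbf\Sigma_T^{-1}\mathbf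 w,\ \frac12\Bigl(\frac{h_T^2\|\mathbf w\|^2}{\rho(\gamma)^2}\ln\Bigl(\frac{\det(\gamma h_1^2\mathbf\Sigma_T)^{-1}}{h_1^2}\,\frac{h_T^2\|\mathbf w\|^2}{\rho(\gamma)^2}\Bigr)+\mathbf w^\top\mathbf\Sigma_T^{-1}\mathbf w\Bigr)\Bigr\}. \] (3) More generally, let $\epsilon>0$ and $\sigma>0$, and replace $\Psi$ (also in the definition of $\hat{\mathbf w}_t$) by \[ \Psi(\mathbf G,\mathbf V,h)=\frac{\epsilon\exp\Bigl(\inf_{\lambda\ge0}\bigl\{\tfrac12\mathbf G^\top(\sigma^{-2}\mathbf I+\gamma\mathbf V+\lambda\mathbf I)^{-1}\mathbf G+\tfrac{\lambda\rho(\gamma)^2}{2h^2}\bigr\}\Bigr)}{\sqrt{\det(\mathbf I+\sigma^2\gamma\mathbf V)}} . \] Then (1) holds verbatim, and under the hypotheses of (2), with $\mathbf\Sigma_T^{-1}=\sigma^{-2}\mathbf I+\gamma\mathbf V_T$, for all $\mathbf w\in\mathbb R^d$, \[ \sum_{t=1}^T\langle\hat{\mathbf w}_t-\mathbf w,\mathbf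 g_t\rangle\le\epsilon+\sqrt{Q_T^{\mathbf w}\,\ln_+\Bigl(\frac{\det(\sigma^2\mathbf\Sigma_T^{-1})}{\epsilon^2}Q_T^{\mathbf w}\Bigr)}, \] \[ Q_T^{\mathbf w}=\max\Bigl\{\mathbf w^\top\mathbf\Sigma_T^{-1}\mathbf w,\ \frac12\Bigl(\frac{h_T^2\|\mathbf w\|^2}{\rho(\gamma)^2}\ln\Bigl(\frac{\det(\sigma^2\mathbf\Sigma_T^{-1})}{\epsilon^2}\,\frac{h_T^2\|\mathbf w\|^2}{\rho(\gamma)^2}\Bigr)+\mathbf w^\top\mathbf\Sigma_T^{-1}\mathbf w\Bigr)\Bigr\}. \] -/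

import Mathlib

namespace MatrixFreeGrad

open scoped Gradient RealInnerProductSpace

noncomputable section

/-- Euclidean space `ℝ^d`. -/
abbrev Vec (d : ℕ) : Type := EuclideanSpace ℝ (Fin d)

/-- Real `d × d` matrices. -/
abbrev Mat (d : ℕ) : Type := Matrix (Fin d) (Fin d) ℝ

/-- The quadratic form `xᵀ A x`. -/
def quad {d : ℕ} (A : Mat d) (x : Vec d) : ℝ :=
  x.ofLp ⬝ᵥ (A.mulVec x.ofLp)

/-- The constant `ρ(γ)`. -/
def rho (γ : ℝ) : ℝ :=
  1 / (2 * γ) *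
    (√((γ + 1) ^ 2 - 4 * Real.exp (1 / (2 * γ) - 1 / 2) * γ ^ (3 / 2 : ℝ)) + γ - 1)

/-- `inf_{l ≥ 0} { ½ Gᵀ (P + l I)⁻¹ G + l ρ(γ)² / (2 h²) }`. For positive definite `P` this is the
infimum of a set of nonnegative reals. -/
def exponent {d : ℕ} (γ : ℝ) (P : Mat d) (G : Vec d) (h : ℝ) : ℝ :=
  ⨅ l : {l : ℝ // 0 ≤ l},
    (1 / 2 * quad (P + (l : ℝ) • (1 : Mat d))⁻¹ G + (l : ℝ) * rho γ ^ 2 / (2 * h ^ 2))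

/-- The sum `G_t = ∑_{s=1}^t g_s`. -/
def gradSum {d : ℕ} (g : ℕ → Vec d) (t : ℕ) : Vec d :=
  ∑ s ∈ Finset.Icc 1 t, g s

/-- The matrix `V_t = ∑_{s=1}^t g_s g_sᵀ`. -/
def gradCov {d : ℕ} (g : ℕ → Vec d) (t : ℕ) : Mat d :=
  ∑ s ∈ Finset.Icc 1 t, Matrix.vecMulVec (g s).ofLp (g s).ofLp

/-- The potential `Ψ(G, V, h)` with prod factor `γ` and initial hint `h₁`. -/
def potential {d : ℕ} (γ h₁ : ℝ) (G : Vec d) (V : Mat d) (h : ℝ) : ℝ :=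
  h₁ * Real.exp (exponent γ ((γ * h₁ ^ 2) • (1 : Mat d) + γ • V) G h) /
    √((1 : Mat d) + (1 / h₁ ^ 2) • V).det

/-- The Matrix-FreeGrad prediction in round `t ≥ 1`: minus the gradient of the potential in its
first argument. It depends only on `g_1, …, g_{t-1}`, `h_1` and `h_t`. -/
def prediction {d : ℕ} (γ : ℝ) (g : ℕ → Vec d) (h : ℕ → ℝ) (t : ℕ) : Vec d :=
  -∇ (fun G : Vec d => potential γ (h 1) G (gradCov g (t - 1)) (h t)) (gradSum g (t - 1))

/-- The untuned potential with prior variance `σ²`, initial wealth `ε` and prod factor `γ`. -/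
def potentialGen {d : ℕ} (ε σ γ : ℝ) (G : Vec d) (V : Mat d) (h : ℝ) : ℝ :=
  ε * Real.exp (exponent γ ((σ ^ 2)⁻¹ • (1 : Mat d) + γ • V) G h) /
    √((1 : Mat d) + (σ ^ 2 * γ) • V).det

/-- The prediction in round `t ≥ 1` obtained from the untuned potential. -/
def predictionGen {d : ℕ} (ε σ γ : ℝ) (g : ℕ → Vec d) (h : ℕ → ℝ) (t : ℕ) : Vec d :=
  -∇ (fun G : Vec d => potentialGen ε σ γ G (gradCov g (t - 1)) (h t)) (gradSum g (t - 1))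

/-- The matrix `Σ_T`, with `Σ_T⁻¹ = γ h₁² I + γ V_T`. -/
def Sig {d : ℕ} (γ h₁ : ℝ) (g : ℕ → Vec d) (T : ℕ) : Mat d :=
  ((γ * h₁ ^ 2) • (1 : Mat d) + γ • gradCov g T)⁻¹

/-- The matrix `Σ_T` of the untuned version, with `Σ_T⁻¹ = σ⁻² I + γ V_T`. -/
def SigGen {d : ℕ} (σ γ : ℝ) (g : ℕ → Vec d) (T : ℕ) : Mat d :=
  ((σ ^ 2)⁻¹ • (1 : Mat d) + γ • gradCov g T)⁻¹

/-- With `P = Σ_T⁻¹` and `D` the factor that multiplies inside the logarithms: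
`max { wᵀ P w, ½ ( (h² ‖w‖² / ρ²) ln (D h² ‖w‖² / ρ²) + wᵀ P w ) }`. At `w = 0` the term
`0 · ln 0` is `0`. -/
def dirVar {d : ℕ} (γ : ℝ) (P : Mat d) (D h : ℝ) (w : Vec d) : ℝ :=
  max (quad P w)
    (1 / 2 * (h ^ 2 * ‖w‖ ^ 2 / rho γ ^ 2 * Real.log (D * (h ^ 2 * ‖w‖ ^ 2 / rho γ ^ 2))
      + quad P w))

/-- The sequence of hints `h` is non-decreasing on the rounds `1, …, T` and `h_t ≥ ‖g_s‖` for all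
`s ≤ t`, i.e. `h_t` bounds the running maximum of the gradient norms. -/
def ValidHints {d : ℕ} (g : ℕ → Vec d) (h : ℕ → ℝ) (T : ℕ) : Prop :=
  MonotoneOn h (Set.Icc 1 T) ∧ ∀ s t, 1 ≤ s → s ≤ t → t ≤ T → ‖g s‖ ≤ h t

end

end MatrixFreeGrad

namespace MatrixFreeGrad

open scoped Gradient RealInnerProductSpace

/-! ### Scalar inequalities -/

/-! The exponent is a Lagrangian dual: it equals the maximum of `⟪u, G⟫ - ½ uᵀPu` over the ball of
radius `ρ/h` (`exists_exponent_maximizer`), and the maximizer `u` is its gradient in `G`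
(`hasGradientAt_exponent`). The prediction is therefore `-Ψ u`, and the one-round decrease says
`Ψ_new ≤ Ψ (1 + r)` with `r = ⟪g, u⟫`, where `|r| ≤ ρ < 1` because `‖g‖ ≤ h`.

Strong concavity around `u` and Cauchy–Schwarz reduce the change of the exponent to a problem in the
scalar `x = ⟪g, v⟫`, with `v` the new maximizer. `quad_prod_bound` bounds it by `½ log(1 + γz) +
log(1 + r)`, `z = gᵀP⁻¹g`. The determinant in the denominator of `Ψ` grows by exactly `1 + γz`, so
the first logarithm cancels and the second gives the factor `1 + r`. The formula for `ρ(γ)` is what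
makes this scalar inequality true.

For the regret, the decreases telescope; raising the hint only lowers `Ψ`. What remains is `-⟪w, G⟫
- Ψ`. Testing the dual at `-w/η`, feasible once `η ≥ h‖w‖/ρ`, and using convexity of `exp` bounds it
by `η log(√D η) - η + wᵀPw/(2η)`; `exists_conjugate_bound` picks `η`. The tuned algorithm is the
general one with `ε = h₁` and `σ⁻² = γh₁²`. -/

theorem sub_sq_le_log_one_add {γ r : ℝ} (hγ : 1 ≤ γ) (hr : (1 - γ) / γ ≤ r) :
    r - γ * r ^ 2 / 2 ≤ Real.log (1 + r) := by
  have hγ0 : 0 < γ := by linarith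
  rcases le_or_gt 0 r with h0 | h0
  · have h1 := Real.le_log_one_add_of_nonneg h0
    refine le_trans ?_ h1
    rw [le_div_iff₀ (by linarith)]
    nlinarith [mul_nonneg (mul_nonneg (sub_nonneg.2 hγ) (sq_nonneg r)) (by linarith : 0 ≤ r + 2),
      pow_nonneg h0 3]
  · rw [div_le_iff₀ hγ0] at hr
    have h1 : 0 < 1 + r := by nlinarith
    have hx1 : 1 ≤ (1 + r)⁻¹ := (one_le_inv₀ h1).2 (by linarith)
    -- For negative `r` put `x = 1/(1+r) ≤ γ`; then `log x ≤ sinh (log x) = (x - 1/x)/2`, and `x -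
    -- 1/x = -2r + x r²`.
    have hs := Real.self_le_sinh_iff.2 (Real.log_nonneg hx1)
    rw [Real.sinh_log (by positivity), inv_inv, Real.log_inv] at hs
    have hxγ : (1 + r)⁻¹ ≤ γ := by
      rw [inv_le_iff_one_le_mul₀ h1]; linarith
    have hid : (1 + r)⁻¹ - (1 + r) = -2 * r + (1 + r)⁻¹ * r ^ 2 := by
      field_simp; ring
    nlinarith [mul_le_mul_of_nonneg_right hxγ (sq_nonneg r)]

theorem rpow_three_halves {γ : ℝ} (hγ : 0 < γ) : γ ^ (3 / 2 : ℝ) = γ * √γ := by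
  rw [show (3 / 2 : ℝ) = 1 + 1 / 2 by norm_num, Real.rpow_add hγ, Real.rpow_one,
    Real.sqrt_eq_rpow]

theorem rho_pos {γ : ℝ} (hγ : 1 < γ) : 0 < rho γ := by
  unfold rho
  have := Real.sqrt_nonneg ((γ + 1) ^ 2 - 4 * Real.exp (1 / (2 * γ) - 1 / 2) * γ ^ (3 / 2 : ℝ))
  have h2 : 0 < 1 / (2 * γ) := by positivity
  exact mul_pos h2 (by linarith)

theorem rho_lt_one {γ : ℝ} (hγ : 1 < γ) : rho γ < 1 := by
  unfold rho
  have h1 : √((γ + 1) ^ 2 - 4 * Real.exp (1 / (2 * γ) - 1 / 2) * γ ^ (3 / 2 : ℝ)) < γ + 1 := by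
    rw [Real.sqrt_lt' (by linarith)]
    have : 0 < Real.exp (1 / (2 * γ) - 1 / 2) * γ ^ (3 / 2 : ℝ) := by positivity
    linarith
  rw [div_mul_eq_mul_div, one_mul, div_lt_one (by linarith)]
  linarith

/-- The right side is a concave quadratic in `r`, and `-ρ` is the smaller root of the corresponding
equation. By concavity it suffices to check the other end of the allowed interval, where `1 - γr =
√γ`; there the claim reduces to the quadratic lower bound on `log (1 + r)`. -/
theorem le_mul_one_add_of_neg_rho_le {γ r : ℝ} (hγ : 1 < γ) (hr : -rho γ ≤ r)
    (hr1 : √γ ≤ 1 - γ * r) :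
    √γ * Real.exp (1 / (2 * γ) - 1 / 2) ≤ (1 - γ * r) * (1 + r) := by
  have hγ0 : 0 < γ := by linarith
  set q := √γ with hq
  have hq1 : 1 < q := by rw [hq, Real.lt_sqrt] <;> linarith
  have hqq : q * q = γ := Real.mul_self_sqrt hγ0.le
  set c := Real.exp (1 / (2 * γ) - 1 / 2) with hc
  set s := -(q - 1) / γ with hs
  have hsγ : γ * s = 1 - q := by rw [hs]; field_simp; ring
  have hend : c ≤ 1 + s := by
    have h1 := sub_sq_le_log_one_add hγ.le (r := s) (by
      rw [hs]; apply div_le_div_of_nonneg_right _ hγ0.le; nlinarith)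
    have h2 : 0 < 1 + s := by
      have : γ * (1 + s) = γ + 1 - q := by rw [mul_add, hsγ]; ring
      have h3 : 0 < γ * (1 + s) := by rw [this]; nlinarith
      exact pos_of_mul_pos_right h3 hγ0.le
    rw [hc, ← Real.le_log_iff_exp_le h2]
    refine le_trans (le_of_eq ?_) h1
    rw [hs]; field_simp; rw [← hqq]; ring
  have hrho : 2 * γ * rho γ = √((γ + 1) ^ 2 - 4 * γ * (q * c)) + γ - 1 := by
    unfold rho
    rw [rpow_three_halves hγ0, ← hq, ← hc]
    rw [show 4 * c * (γ * q) = 4 * γ * (q * c) by ring]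
    field_simp
  have hsq : (2 * γ * s + γ - 1) ^ 2 ≤ (γ + 1) ^ 2 - 4 * γ * (q * c) := by
    have h1 : q * c ≤ q * (1 + s) := mul_le_mul_of_nonneg_left hend (by linarith)
    have h2 : 4 * γ * (q * c) ≤ 4 * γ * (q * (1 + s)) :=
      mul_le_mul_of_nonneg_left h1 (by linarith)
    have h3 : 4 * γ * (q * (1 + s)) = (γ + 1) ^ 2 - (2 * γ * s + γ - 1) ^ 2 := by
      have h4 : q = 1 - γ * s := by linarith
      rw [h4]; ring
    linarith
  -- The discriminant in `rho` is genuinely nonnegative, so the square root is not a default zero.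
  have hD : 0 ≤ (γ + 1) ^ 2 - 4 * γ * (q * c) := (sq_nonneg _).trans hsq
  set D := √((γ + 1) ^ 2 - 4 * γ * (q * c)) with hDdef
  have hD2 : D ^ 2 = (γ + 1) ^ 2 - 4 * γ * (q * c) := Real.sq_sqrt hD
  have hD0 : 0 ≤ D := Real.sqrt_nonneg _
  have hrs : γ * r ≤ γ * s := by linarith
  have hle : (2 * γ * r + γ - 1) ^ 2 ≤ D ^ 2 := by
    have hγr : -(γ * rho γ) ≤ γ * r := by
      have := mul_le_mul_of_nonneg_left hr hγ0.le; linarith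
    rcases le_or_gt (2 * γ * r + γ - 1) 0 with h0 | h0
    · exact sq_le_sq' (by linarith) (by linarith)
    · rw [hD2]
      refine le_trans ?_ hsq
      exact sq_le_sq' (by linarith) (by linarith)
  have : 0 ≤ 4 * γ * ((1 - γ * r) * (1 + r) - q * c) := by
    have : 4 * γ * ((1 - γ * r) * (1 + r) - q * c) = D ^ 2 - (2 * γ * r + γ - 1) ^ 2 := by
      rw [hD2]; ring
    linarith
  have h4 : 0 ≤ (1 - γ * r) * (1 + r) - q * c := by
    by_contra hneg
    push Not at hneg
    nlinarith
  linarith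

/-- With `a = (1 - γr)²/γ`, the function `log s - a s` peaks at `s = 1/a`. If `a ≤ 1` the worst case
on `(0, 1]` is `s = 1`, settled by the quadratic log bound. If `a > 1`, `log (as) ≤ as - 1`
eliminates `s`; the remaining condition on `r` is easy for `r ≥ 0`, and for `r < 0` it is the one
defining `ρ`. -/
theorem prod_bound_aux {γ r s : ℝ} (hγ : 1 < γ) (hr : |r| ≤ rho γ) (hs : 0 < s) (hs1 : s ≤ 1) :
    1 / γ - (1 - γ * r) ^ 2 / γ * s ≤ -Real.log s + 2 * Real.log (1 + r) := by
  have hγ0 : 0 < γ := by linarith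
  obtain ⟨hr1, hr2⟩ := abs_le.1 hr
  have hρ := rho_lt_one hγ
  set a := (1 - γ * r) ^ 2 / γ with ha
  have haγ : a * γ = (1 - γ * r) ^ 2 := by rw [ha]; field_simp
  have hq1 : 1 < √γ := by rw [Real.lt_sqrt] <;> linarith
  have hqq : √γ * √γ = γ := Real.mul_self_sqrt hγ0.le
  have hlogs := Real.log_le_sub_one_of_pos hs
  rcases le_or_gt a 1 with h1 | h1
  · have hle : (1 - γ * r) ^ 2 ≤ γ := by nlinarith
    have h2 := sub_sq_le_log_one_add hγ.le (r := r) (by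
      rw [div_le_iff₀ hγ0]
      nlinarith [sq_nonneg (γ * r + γ - 1)])
    have h3 : 1 / γ - a = 2 * r - γ * r ^ 2 := by rw [ha]; field_simp; ring
    nlinarith
  · have hapos : 0 < a := by linarith
    have h2 := Real.log_le_sub_one_of_pos (mul_pos hapos hs)
    rw [Real.log_mul hapos.ne' hs.ne'] at h2
    have hr0 : 0 < 1 + r := by linarith
    suffices 1 / γ - 1 ≤ Real.log a + 2 * Real.log (1 + r) by linarith
    rcases le_or_gt 0 r with h0 | h0
    · have h3 : 0 ≤ Real.log a := Real.log_nonneg h1.le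
      have h4 : 0 ≤ Real.log (1 + r) := Real.log_nonneg (by linarith)
      have h5 : 1 / γ ≤ 1 := by rw [div_le_one hγ0]; linarith
      linarith
    · have hγr : γ * r < 0 := mul_neg_of_pos_of_neg hγ0 h0
      have hroot : √γ ≤ 1 - γ * r := by
        refine Real.sqrt_le_iff.2 ⟨by linarith, ?_⟩
        nlinarith
      have h3 := le_mul_one_add_of_neg_rho_le hγ hr1 hroot
      have h4 := Real.log_le_log (by positivity) h3
      rw [Real.log_mul (by positivity) (by positivity), Real.log_exp,
        Real.log_mul (by linarith) hr0.ne', Real.log_sqrt hγ0.le] at h4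
      have h5 : Real.log a = 2 * Real.log (1 - γ * r) - Real.log γ := by
        rw [ha, Real.log_div (by nlinarith) hγ0.ne', Real.log_pow]; norm_num
      have h6 : 1 / (2 * γ) = 1 / γ / 2 := by field_simp
      rw [h5]; linarith

theorem prod_bound {γ r z : ℝ} (hγ : 1 < γ) (hr : |r| ≤ rho γ) (hz : 0 ≤ z) :
    (z + 2 * r - γ * r ^ 2) / (2 * (1 + γ * z)) ≤
      1 / 2 * Real.log (1 + γ * z) + Real.log (1 + r) := by
  have hγ0 : 0 < γ := by linarith
  have h1 : 1 ≤ 1 + γ * z := by nlinarith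
  have h := prod_bound_aux hγ hr (s := (1 + γ * z)⁻¹) (by positivity) (inv_le_one_of_one_le₀ h1)
  rw [Real.log_inv, neg_neg] at h
  have h2 : 1 / γ - (1 - γ * r) ^ 2 / γ * (1 + γ * z)⁻¹ =
      2 * ((z + 2 * r - γ * r ^ 2) / (2 * (1 + γ * z))) := by
    have : 1 + γ * z ≠ 0 := by positivity
    field_simp; ring
  linarith

/-- The one-dimensional decrease inequality: `x` and `r` are the margins of a competing point and of
the maximizer, and `z` is the squared length of the gradient in the dual norm. -/
theorem quad_prod_bound {γ r x z : ℝ} (hγ : 1 < γ) (hr : |r| ≤ rho γ) (hz : 0 < z) :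
    x - γ / 2 * x ^ 2 - (x - r) ^ 2 / (2 * z) ≤
      1 / 2 * Real.log (1 + γ * z) + Real.log (1 + r) := by
  refine le_trans ?_ (prod_bound hγ hr hz.le)
  have hγ0 : 0 < γ := by linarith
  have h1 : 0 < 1 + γ * z := by positivity
  rw [← sub_nonneg]
  -- The left term is the maximum over `x`, so the gap is a perfect square.
  have : (z + 2 * r - γ * r ^ 2) / (2 * (1 + γ * z)) -
      (x - γ / 2 * x ^ 2 - (x - r) ^ 2 / (2 * z)) =
      ((1 + γ * z) * x - (z + r)) ^ 2 / (2 * z * (1 + γ * z)) := by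
    field_simp; ring
  rw [this]; positivity

/-- The scale-one version of the bound on the conjugate of the exponential. -/
theorem exists_conjugate_bound_one {A b Q : ℝ} (hA : 0 ≤ A) (hb : 0 ≤ b) (hAQ : A ≤ Q)
    (hbQ : 1 / 2 * (b ^ 2 * Real.log (b ^ 2) + A) ≤ Q) :
    ∃ η, 0 < η ∧ b ≤ η ∧
      η * Real.log η - η + A / (2 * η) ≤ √(Q * max 0 (Real.log Q)) := by
  have hQ0 : 0 ≤ Q := hA.trans hAQ
  -- The choice `η = b` is where the logarithmic term of `Q` comes from.
  have hval : 0 < b → b * Real.log b - b + A / (2 * b) ≤ Q / b - b := by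
    intro hb0
    have : b * Real.log b - b + A / (2 * b) =
        (1 / 2 * (b ^ 2 * Real.log (b ^ 2) + A)) / b - b := by
      rw [Real.log_pow]; field_simp; push_cast; ring
    rw [this]
    gcongr
  rcases le_or_gt Q 2 with h2 | h2
  · rcases le_or_gt b 1 with h1 | h1
    · refine ⟨1, one_pos, h1, le_trans ?_ (Real.sqrt_nonneg _)⟩
      rw [Real.log_one]; linarith
    · refine ⟨b, by linarith, le_rfl, (hval (by linarith)).trans ?_⟩
      have h3 : Q / b - b ≤ Q - 1 := by
        have : Q / b ≤ Q := div_le_self hQ0 h1.le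
        linarith
      refine h3.trans ?_
      rcases le_or_gt Q 1 with h4 | h4
      · exact le_trans (by linarith) (Real.sqrt_nonneg _)
      · apply Real.le_sqrt_of_sq_le
        have h5 := Real.one_sub_inv_le_log_of_pos (by linarith : 0 < Q)
        have h6 : Q - 1 ≤ Q * Real.log Q := by
          have := mul_le_mul_of_nonneg_left h5 hQ0
          rwa [mul_sub, mul_one, mul_inv_cancel₀ (by linarith)] at this
        have h7 : Q * Real.log Q ≤ Q * max 0 (Real.log Q) :=
          mul_le_mul_of_nonneg_left (le_max_right _ _) hQ0
        nlinarith
  · set l := Real.log Q with hl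
    have hl2 : 0.69 ≤ l := by
      have := Real.log_le_log (by norm_num) h2.le
      linarith [Real.log_two_gt_d9]
    have hlpos : 0 < l := by linarith
    have hQpos : 0 < Q := by linarith
    rw [max_eq_right hlpos.le]
    -- For large `Q` the choice is `η = max m b`, since `m` satisfies `m l = √(Q l)`, the target
    -- value.
    set m := √(Q / l) with hm
    have hm0 : 0 < m := Real.sqrt_pos.2 (by positivity)
    have hm2 : m ^ 2 = Q / l := Real.sq_sqrt (by positivity)
    have hml : m ^ 2 * l = Q := by rw [hm2]; field_simp
    have hR : √(Q * l) = m * l := by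
      rw [Real.sqrt_eq_iff_mul_self_eq (by positivity) (by positivity), ← hml]; ring
    rw [hR]
    rcases le_or_gt b m with h1 | h1
    · refine ⟨m, hm0, h1, ?_⟩
      have hlm : Real.log m = 1 / 2 * (l - Real.log l) := by
        rw [hm, Real.log_sqrt (by positivity), Real.log_div hQpos.ne' hlpos.ne']; ring
      have hAm : A / (2 * m) ≤ m * l / 2 := by
        rw [div_le_iff₀ (by positivity)]
        nlinarith
      have hll : -2 ≤ Real.log l := by
        have h5 := Real.one_sub_inv_le_log_of_pos hlpos
        have : l⁻¹ ≤ 3 := by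
          rw [inv_le_comm₀ hlpos (by norm_num)]; linarith
        linarith
      rw [hlm]
      nlinarith
    · have hb0 : 0 < b := hm0.trans h1
      refine ⟨b, hb0, le_rfl, (hval hb0).trans ?_⟩
      have : Q / b ≤ m * l := by
        rw [div_le_iff₀ hb0, ← hml]
        nlinarith [mul_pos hm0 hlpos]
      linarith

/-- Rescaling `η` and `b` by `√D`, and `A` and `Q` by `D`, reduces to `D = 1`. -/
theorem exists_conjugate_bound {A b D Q : ℝ} (hA : 0 ≤ A) (hb : 0 ≤ b) (hD : 0 < D)
    (hAQ : A ≤ Q) (hbQ : 1 / 2 * (b ^ 2 * Real.log (D * b ^ 2) + A) ≤ Q) :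
    ∃ η, 0 < η ∧ b ≤ η ∧
      η * Real.log (√D * η) - η + A / (2 * η) ≤ √(Q * max 0 (Real.log (D * Q))) := by
  set k := √D with hk
  have hk0 : 0 < k := Real.sqrt_pos.2 hD
  have hkk : k ^ 2 = D := Real.sq_sqrt hD.le
  obtain ⟨η, h1, h2, h3⟩ := exists_conjugate_bound_one (A := D * A) (b := k * b) (Q := D * Q)
    (by positivity) (by positivity) (by gcongr) (by
      rw [mul_pow, hkk]
      have := mul_le_mul_of_nonneg_left hbQ hD.le
      linarith)
  refine ⟨η / k, by positivity, by rw [le_div_iff₀ hk0]; linarith, ?_⟩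
  have h4 : √(D * Q * max 0 (Real.log (D * Q))) = k * √(Q * max 0 (Real.log (D * Q))) := by
    rw [mul_assoc, Real.sqrt_mul hD.le]
  rw [h4] at h3
  have h5 : k * (η / k) = η := by field_simp
  rw [h5]
  have h6 : η / k * Real.log η - η / k + A / (2 * (η / k)) =
      (η * Real.log η - η + D * A / (2 * η)) / k := by
    rw [← hkk]; field_simp
  rw [h6, div_le_iff₀ hk0]; linarith

variable {d : ℕ}

/-! ### Quadratic forms -/

theorem quad_eq_inner (A : Mat d) (x : Vec d) : quad A x = ⟪x, Matrix.toEuclideanLin A x⟫ := by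
  rw [quad, EuclideanSpace.inner_eq_star_dotProduct, dotProduct_comm]
  simp

theorem inner_toEuclideanLin_comm {A : Mat d} (hA : A.IsHermitian) (x y : Vec d) :
    ⟪x, Matrix.toEuclideanLin A y⟫ = ⟪y, Matrix.toEuclideanLin A x⟫ := by
  rw [← (Matrix.isSymmetric_toEuclideanLin_iff.2 hA) x y, real_inner_comm]

theorem quad_nonneg {A : Mat d} (hA : A.PosSemidef) (x : Vec d) : 0 ≤ quad A x := by
  simpa [quad] using hA.dotProduct_mulVec_nonneg x.ofLp

theorem quad_pos {A : Mat d} (hA : A.PosDef) {x : Vec d} (hx : x ≠ 0) : 0 < quad A x := by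
  have : x.ofLp ≠ 0 := by simpa using hx
  simpa [quad] using hA.dotProduct_mulVec_pos this

theorem quad_add {A : Mat d} (hA : A.IsHermitian) (x y : Vec d) :
    quad A (x + y) = quad A x + 2 * ⟪y, Matrix.toEuclideanLin A x⟫ + quad A y := by
  simp only [quad_eq_inner, map_add, inner_add_left, inner_add_right]
  rw [inner_toEuclideanLin_comm hA x y]; ring

theorem quad_smul (A : Mat d) (c : ℝ) (x : Vec d) : quad A (c • x) = c ^ 2 * quad A x := by
  simp only [quad_eq_inner, map_smul, inner_smul_left, inner_smul_right]
  simp; ring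

theorem quad_neg (A : Mat d) (x : Vec d) : quad A (-x) = quad A x := by
  simpa using quad_smul A (-1) x

theorem quad_add_smul_one (A : Mat d) (c : ℝ) (x : Vec d) :
    quad (A + c • (1 : Mat d)) x = quad A x + c * ‖x‖ ^ 2 := by
  rw [quad, Matrix.add_mulVec, dotProduct_add, Matrix.smul_mulVec, Matrix.one_mulVec,
    dotProduct_smul, EuclideanSpace.real_norm_sq_eq]
  simp [quad, dotProduct, pow_two]

theorem quad_vecMulVec (g x : Vec d) :
    quad (Matrix.vecMulVec g.ofLp g.ofLp) x = ⟪g, x⟫ ^ 2 := by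
  rw [quad, Matrix.vecMulVec_mulVec, EuclideanSpace.inner_eq_star_dotProduct]
  simp [dotProduct_comm g.ofLp, pow_two]

theorem quad_matrix_add (A B : Mat d) (x : Vec d) : quad (A + B) x = quad A x + quad B x := by
  rw [quad, Matrix.add_mulVec, dotProduct_add]; rfl

theorem quad_matrix_smul (c : ℝ) (A : Mat d) (x : Vec d) : quad (c • A) x = c * quad A x := by
  rw [quad, Matrix.smul_mulVec, dotProduct_smul]; rfl

theorem toEuclideanLin_mul_inv {A : Mat d} (hA : A.PosDef) (x : Vec d) :
    Matrix.toEuclideanLin A (Matrix.toEuclideanLin A⁻¹ x) = x := by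
  have := hA.isUnit
  apply WithLp.ofLp_injective
  simp [Matrix.mulVec_mulVec, Matrix.mul_nonsing_inv A ((Matrix.isUnit_iff_isUnit_det A).1 this)]

theorem toEuclideanLin_add_smul_one (A : Mat d) (c : ℝ) (x : Vec d) :
    Matrix.toEuclideanLin (A + c • (1 : Mat d)) x = Matrix.toEuclideanLin A x + c • x := by
  apply WithLp.ofLp_injective
  simp

/-- The Fenchel–Young inequality for the quadratic form of a positive definite matrix. -/
theorem inner_le_quad_add_quad_inv {A : Mat d} (hA : A.PosDef) (x y : Vec d) :
    ⟪x, y⟫ ≤ 1 / 2 * quad A x + 1 / 2 * quad A⁻¹ y := by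
  set b := Matrix.toEuclideanLin A⁻¹ y with hb
  have hAb : Matrix.toEuclideanLin A b = y := toEuclideanLin_mul_inv hA y
  have h0 := quad_nonneg hA.posSemidef (x + -b)
  rw [quad_add hA.isHermitian, quad_neg, inner_neg_left, inner_toEuclideanLin_comm hA.isHermitian,
    quad_eq_inner A b, hAb] at h0
  rw [quad_eq_inner A⁻¹, ← hb, real_inner_comm]
  rw [real_inner_comm x y, real_inner_comm y b] at *
  linarith

/-- Fenchel–Young with the optimal rescaling of `y`. -/
theorem inner_sq_le_quad_mul_quad_inv {A : Mat d} (hA : A.PosDef) (x : Vec d) {y : Vec d}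
    (hy : y ≠ 0) : ⟪x, y⟫ ^ 2 / quad A⁻¹ y ≤ quad A x := by
  have hz : 0 < quad A⁻¹ y := quad_pos hA.inv hy
  have h := inner_le_quad_add_quad_inv hA x ((⟪x, y⟫ / quad A⁻¹ y) • y)
  rw [inner_smul_right, quad_smul] at h
  have h2 : ⟪x, y⟫ / quad A⁻¹ y * ⟪x, y⟫ = ⟪x, y⟫ ^ 2 / quad A⁻¹ y := by ring
  have h3 : (⟪x, y⟫ / quad A⁻¹ y) ^ 2 * quad A⁻¹ y = ⟪x, y⟫ ^ 2 / quad A⁻¹ y := by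
    field_simp
  rw [h2, h3] at h
  linarith

theorem posDef_add_smul_one {P : Mat d} (hP : P.PosDef) {l : ℝ} (hl : 0 ≤ l) :
    (P + l • (1 : Mat d)).PosDef :=
  hP.add_posSemidef (Matrix.PosSemidef.one.smul hl)

theorem exists_quad_le (A : Mat d) : ∃ C, 0 ≤ C ∧ ∀ x : Vec d, quad A x ≤ C * ‖x‖ ^ 2 := by
  refine ⟨‖(Matrix.toEuclideanLin A).toContinuousLinearMap‖, norm_nonneg _, fun x => ?_⟩
  rw [quad_eq_inner]
  refine (real_inner_le_norm _ _).trans ?_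
  have := (Matrix.toEuclideanLin A).toContinuousLinearMap.le_opNorm x
  simp only [LinearMap.coe_toContinuousLinearMap'] at this
  nlinarith [norm_nonneg x]

/-! ### The dual form of the exponent -/

theorem continuousOn_resolvent {P : Mat d} (hP : P.PosDef) (G : Vec d) :
    ContinuousOn (fun l : ℝ => Matrix.toEuclideanLin (P + l • (1 : Mat d))⁻¹ G) (Set.Ici 0) := by
  have hc : Continuous fun l : ℝ => P + l • (1 : Mat d) := by fun_prop
  have hinv : ContinuousOn (fun l : ℝ => (P + l • (1 : Mat d))⁻¹) (Set.Ici 0) := by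
    simp only [Matrix.inv_def, Ring.inverse_eq_inv']
    refine ContinuousOn.smul (ContinuousOn.inv₀ hc.matrix_det.continuousOn ?_)
      hc.matrix_adjugate.continuousOn
    intro l hl
    exact (posDef_add_smul_one hP hl).det_pos.ne'
  have : (fun l : ℝ => Matrix.toEuclideanLin (P + l • (1 : Mat d))⁻¹ G) =
      fun l : ℝ => WithLp.toLp 2 ((P + l • (1 : Mat d))⁻¹.mulVec G.ofLp) := by
    ext l; simp
  rw [this]
  refine (PiLp.continuous_toLp 2 _).comp_continuousOn ?_
  have h2 : Continuous fun M : Mat d => M.mulVec G.ofLp :=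
    Continuous.matrix_mulVec continuous_id continuous_const
  exact h2.comp_continuousOn hinv

/-- The Karush–Kuhn–Tucker conditions for maximizing `⟪u, G⟫ - ½ uᵀ P u` over the ball of
radius `c`. -/
theorem exists_kkt {P : Mat d} (hP : P.PosDef) (G : Vec d) {c : ℝ} (hc : 0 < c) :
    ∃ (l : ℝ) (u : Vec d), 0 ≤ l ∧ u = Matrix.toEuclideanLin (P + l • (1 : Mat d))⁻¹ G ∧
      ‖u‖ ≤ c ∧ l * ‖u‖ ^ 2 = l * c ^ 2 := by
  set r := fun l : ℝ => Matrix.toEuclideanLin (P + l • (1 : Mat d))⁻¹ G with hr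
  rcases le_or_gt ‖r 0‖ c with h0 | h0
  · exact ⟨0, r 0, le_rfl, rfl, h0, by simp⟩
  · have hG : 0 < ‖G‖ := by
      rw [norm_pos_iff]
      rintro rfl
      simp [hr] at h0
      linarith
    -- A multiplier this large already forces the resolvent into the ball, since `P + mI ≥ mI`; the
    -- intermediate value theorem then finds one that lands on the sphere.
    set m := ‖G‖ / c with hm
    have hm0 : 0 < m := by positivity
    have hle : ‖r m‖ ≤ c := by
      have hPm := posDef_add_smul_one hP hm0.le
      have h1 : quad (P + m • (1 : Mat d)) (r m) = ⟪r m, G⟫ := by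
        rw [quad_eq_inner, hr, toEuclideanLin_mul_inv hPm]
      rw [quad_add_smul_one] at h1
      have h2 := quad_nonneg hP.posSemidef (r m)
      have h3 := real_inner_le_norm (r m) G
      have h4 : ‖G‖ = m * c := by rw [hm]; field_simp
      rw [h4] at h3
      by_contra hlt
      push Not at hlt
      have h5 : 0 < m * ‖r m‖ := mul_pos hm0 (hc.trans hlt)
      nlinarith [mul_pos h5 (sub_pos.2 hlt)]
    have hcont : ContinuousOn (fun l => ‖r l‖) (Set.Icc 0 m) :=
      ((continuousOn_resolvent hP G).mono Set.Icc_subset_Ici_self).norm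
    obtain ⟨l, hl, hlc⟩ := intermediate_value_Icc' hm0.le hcont ⟨hle, h0.le⟩
    exact ⟨l, r l, hl.1, rfl, hlc.le, by rw [← hlc]⟩

theorem rho_sq_div {γ h : ℝ} (l : ℝ) : l * rho γ ^ 2 / (2 * h ^ 2) = l / 2 * (rho γ / h) ^ 2 := by
  rw [div_pow]; ring

/-- Strong duality: the exponent is the maximum of `⟪u, G⟫ - ½ uᵀ P u` over the ball of radius
`ρ / h`, and the objective is strongly concave around its maximizer. -/
theorem exists_exponent_maximizer {γ h : ℝ} (hγ : 1 < γ) (hh : 0 < h) {P : Mat d} (hP : P.PosDef)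
    (G : Vec d) :
    ∃ u : Vec d, ‖u‖ ≤ rho γ / h ∧ exponent γ P G h = ⟪u, G⟫ - 1 / 2 * quad P u ∧
      ∀ v : Vec d, ‖v‖ ≤ rho γ / h →
        ⟪v, G⟫ - 1 / 2 * quad P v ≤ exponent γ P G h - 1 / 2 * quad P (v - u) := by
  have hc : 0 < rho γ / h := div_pos (rho_pos hγ) hh
  obtain ⟨l, u, hl, hu, huc, hsl⟩ := exists_kkt hP G hc
  set c := rho γ / h with hcdef
  have hPl := posDef_add_smul_one hP hl
  have hGu : G = Matrix.toEuclideanLin P u + l • u := by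
    rw [← toEuclideanLin_add_smul_one, hu, toEuclideanLin_mul_inv hPl]
  have hweak : ∀ l' : {l : ℝ // 0 ≤ l}, ⟪u, G⟫ - 1 / 2 * quad P u ≤
      1 / 2 * quad (P + (l' : ℝ) • (1 : Mat d))⁻¹ G + (l' : ℝ) * rho γ ^ 2 / (2 * h ^ 2) := by
    rintro ⟨l', hl'⟩
    have h1 := inner_le_quad_add_quad_inv (posDef_add_smul_one hP hl') u G
    rw [quad_add_smul_one] at h1
    have h2 : l' * ‖u‖ ^ 2 ≤ l' * c ^ 2 :=
      mul_le_mul_of_nonneg_left (pow_le_pow_left₀ (norm_nonneg _) huc 2) hl'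
    rw [rho_sq_div]
    simp only
    linarith
  have hval : ⟪u, G⟫ - 1 / 2 * quad P u =
      1 / 2 * quad (P + l • (1 : Mat d))⁻¹ G + l * rho γ ^ 2 / (2 * h ^ 2) := by
    rw [rho_sq_div, quad_eq_inner _ G, ← hu, real_inner_comm u G]
    have h1 : ⟪u, G⟫ = quad P u + l * ‖u‖ ^ 2 := by
      conv_lhs => rw [hGu]
      rw [inner_add_right, ← quad_eq_inner, inner_smul_right, real_inner_self_eq_norm_sq]
    rw [← hcdef]
    linarith
  have hexp : exponent γ P G h = ⟪u, G⟫ - 1 / 2 * quad P u := by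
    apply le_antisymm
    · rw [hval]
      exact ciInf_le (f := fun l : {l : ℝ // 0 ≤ l} =>
        1 / 2 * quad (P + (l : ℝ) • (1 : Mat d))⁻¹ G + (l : ℝ) * rho γ ^ 2 / (2 * h ^ 2))
        ⟨_, Set.forall_mem_range.2 hweak⟩ ⟨l, hl⟩
    · have : Nonempty {l : ℝ // 0 ≤ l} := ⟨⟨0, le_rfl⟩⟩
      exact le_ciInf hweak
  refine ⟨u, huc, hexp, fun v hv => ?_⟩
  rw [hexp]
  have h1 : v = u + (v - u) := by abel
  have h2 : quad P v = quad P u + 2 * ⟪v - u, Matrix.toEuclideanLin P u⟫ + quad P (v - u) := by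
    conv_lhs => rw [h1]
    exact quad_add hP.isHermitian _ _
  have h3 : ⟪v, G⟫ = ⟪u, G⟫ + ⟪v - u, G⟫ := by rw [← inner_add_left, ← h1]
  have h4 : ⟪v - u, G⟫ = ⟪v - u, Matrix.toEuclideanLin P u⟫ + l * (⟪v, u⟫ - ‖u‖ ^ 2) := by
    conv_lhs => rw [hGu]
    rw [inner_add_right, inner_smul_right, inner_sub_left v u u, real_inner_self_eq_norm_sq]
  have h5 : l * (⟪v, u⟫ - ‖u‖ ^ 2) ≤ 0 := by
    -- Complementary slackness `l‖u‖² = l c²` turns this into the sign of the multiplier term.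
    have h6 : ⟪v, u⟫ ≤ c ^ 2 := (real_inner_le_norm v u).trans (by
      rw [pow_two]; exact mul_le_mul hv huc (norm_nonneg _) hc.le)
    have := mul_le_mul_of_nonneg_left h6 hl
    linarith
  linarith

theorem inner_sub_quad_le_exponent {γ h : ℝ} (hγ : 1 < γ) (hh : 0 < h) {P : Mat d}
    (hP : P.PosDef) (G : Vec d) {v : Vec d} (hv : ‖v‖ ≤ rho γ / h) :
    ⟪v, G⟫ - 1 / 2 * quad P v ≤ exponent γ P G h := by
  obtain ⟨u, -, -, h3⟩ := exists_exponent_maximizer hγ hh hP G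
  have := h3 v hv
  have := quad_nonneg hP.posSemidef (v - u)
  linarith

/-- A larger hint shrinks the feasible ball of the dual problem. -/
theorem exponent_antitone {γ h k : ℝ} (hγ : 1 < γ) (hh : 0 < h) (hk : h ≤ k) {P : Mat d}
    (hP : P.PosDef) (G : Vec d) : exponent γ P G k ≤ exponent γ P G h := by
  obtain ⟨u, h1, h2, -⟩ := exists_exponent_maximizer hγ (hh.trans_le hk) hP G
  rw [h2]
  exact inner_sub_quad_le_exponent hγ hh hP G
    (h1.trans (div_le_div_of_nonneg_left (rho_pos hγ).le hh hk))

theorem exponent_zero {γ h : ℝ} (hγ : 1 < γ) (hh : 0 < h) {P : Mat d}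
    (hP : P.PosDef) : exponent γ P 0 h = 0 := by
  obtain ⟨u, h1, h2, -⟩ := exists_exponent_maximizer hγ hh hP 0
  apply le_antisymm
  · rw [h2, inner_zero_right]
    linarith [quad_nonneg hP.posSemidef u]
  · have := inner_sub_quad_le_exponent hγ hh hP 0 (v := 0)
      (by simpa using (div_pos (rho_pos hγ) hh).le)
    simpa [quad] using this

/-- The maximizer in the dual form of the exponent is its gradient. -/
theorem hasGradientAt_exponent {γ h : ℝ} (hγ : 1 < γ) (hh : 0 < h) {P : Mat d} (hP : P.PosDef)
    {G u : Vec d} (hu : ‖u‖ ≤ rho γ / h) (hval : exponent γ P G h = ⟪u, G⟫ - 1 / 2 * quad P u)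
    (hmax : ∀ v : Vec d, ‖v‖ ≤ rho γ / h →
      ⟪v, G⟫ - 1 / 2 * quad P v ≤ exponent γ P G h - 1 / 2 * quad P (v - u)) :
    HasGradientAt (fun G => exponent γ P G h) u G := by
  obtain ⟨C, hC, hCle⟩ := exists_quad_le P⁻¹
  rw [hasGradientAt_iff_isLittleO]
  have hO : (fun G' => exponent γ P G' h - exponent γ P G h - ⟪u, G' - G⟫) =O[nhds G]
      fun G' => ‖G' - G‖ ^ 2 := by
    refine Asymptotics.IsBigO.of_bound C (Filter.Eventually.of_forall fun G' => ?_)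
    have hlow : 0 ≤ exponent γ P G' h - exponent γ P G h - ⟪u, G' - G⟫ := by
      have := inner_sub_quad_le_exponent hγ hh hP G' hu
      rw [inner_sub_right]
      linarith
    have hup : exponent γ P G' h - exponent γ P G h - ⟪u, G' - G⟫ ≤ C * ‖G' - G‖ ^ 2 := by
      obtain ⟨v, hv1, hv2, -⟩ := exists_exponent_maximizer hγ hh hP G'
      have h1 := hmax v hv1
      -- The strong concavity term in `hmax` absorbs the cross term `⟪v - u, G' - G⟫`, leaving a
      -- quadratic remainder.
      have h2 := inner_le_quad_add_quad_inv hP (v - u) (G' - G)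
      have h3 := hCle (G' - G)
      have h4 := quad_nonneg hP.inv.posSemidef (G' - G)
      simp only [inner_sub_left, inner_sub_right] at h2 ⊢
      linarith
    rw [Real.norm_of_nonneg hlow, Real.norm_of_nonneg (by positivity)]
    exact hup
  exact hO.trans_isLittleO (by
    have : (fun x : ℝ => x ^ 2) =o[nhds 0] fun x => x := by
      simpa using Asymptotics.isLittleO_pow_id (𝕜 := ℝ) (n := 2) (by norm_num)
    have h2 : Filter.Tendsto (fun G' => ‖G' - G‖) (nhds G) (nhds 0) := by
      have : Continuous fun G' : Vec d => ‖G' - G‖ := by fun_prop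
      simpa using this.tendsto G
    exact (this.comp_tendsto h2).of_norm_right)

/-! ### The potential -/

theorem posSemidef_gradCov (g : ℕ → Vec d) (t : ℕ) : (gradCov g t).PosSemidef :=
  Matrix.posSemidef_sum _ fun s _ => by
    simpa using Matrix.posSemidef_vecMulVec_self_star (g s).ofLp

theorem gradSum_succ (g : ℕ → Vec d) (t : ℕ) : gradSum g (t + 1) = gradSum g t + g (t + 1) :=
  Finset.sum_Icc_succ_top (by omega) _

theorem gradCov_succ (g : ℕ → Vec d) (t : ℕ) :
    gradCov g (t + 1) = gradCov g t + Matrix.vecMulVec (g (t + 1)).ofLp (g (t + 1)).ofLp :=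
  Finset.sum_Icc_succ_top (by omega) _

theorem posDef_precision {σ γ : ℝ} (hσ : 0 < σ) (hγ : 0 < γ) {V : Mat d} (hV : V.PosSemidef) :
    ((σ ^ 2)⁻¹ • (1 : Mat d) + γ • V).PosDef :=
  (Matrix.PosDef.one.smul (by positivity)).add_posSemidef (hV.smul hγ.le)

theorem sq_smul_precision {σ : ℝ} (γ : ℝ) (hσ : 0 < σ) (V : Mat d) :
    σ ^ 2 • ((σ ^ 2)⁻¹ • (1 : Mat d) + γ • V) = 1 + (σ ^ 2 * γ) • V := by
  rw [smul_add, smul_smul, smul_smul, mul_inv_cancel₀ (by positivity), one_smul]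

theorem det_one_add_smul_pos {σ γ : ℝ} (hσ : 0 < σ) (hγ : 0 < γ) {V : Mat d}
    (hV : V.PosSemidef) : 0 < ((1 : Mat d) + (σ ^ 2 * γ) • V).det := by
  rw [← sq_smul_precision γ hσ]
  exact ((posDef_precision hσ hγ hV).smul (by positivity)).det_pos

theorem det_add_smul_vecMulVec {P : Mat d} (hP : P.PosDef) (c : ℝ) (g : Vec d) :
    (P + c • Matrix.vecMulVec g.ofLp g.ofLp).det = P.det * (1 + c * quad P⁻¹ g) := by
  rw [← Matrix.smul_vecMulVec, Matrix.vecMulVec_eq Unit,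
    Matrix.det_add_replicateCol_mul_replicateRow hP.det_pos.ne'.isUnit]
  congr 1
  rw [Matrix.det_unique, Matrix.add_apply, Matrix.one_apply_eq, Matrix.mul_assoc,
    ← Matrix.replicateCol_mulVec, Matrix.replicateRow_mul_replicateCol_apply, Matrix.mulVec_smul,
    dotProduct_smul]
  rfl

/-- The new maximizer `v` is compared with `u` in the old problem; only its component along `g`
matters, because `quad P (v - u)` is at least `⟪g, v - u⟫² / quad P⁻¹ g`. -/
theorem exponent_add_le {γ h : ℝ} (hγ : 1 < γ) (hh : 0 < h) {P : Mat d} (hP : P.PosDef)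
    {G u : Vec d} (hu : ‖u‖ ≤ rho γ / h)
    (hmax : ∀ v : Vec d, ‖v‖ ≤ rho γ / h →
      ⟪v, G⟫ - 1 / 2 * quad P v ≤ exponent γ P G h - 1 / 2 * quad P (v - u))
    {g : Vec d} (hg : ‖g‖ ≤ h) (hg0 : g ≠ 0) :
    exponent γ (P + γ • Matrix.vecMulVec g.ofLp g.ofLp) (G + g) h ≤
      exponent γ P G h + 1 / 2 * Real.log (1 + γ * quad P⁻¹ g) + Real.log (1 + ⟪g, u⟫) := by
  have hγ0 : 0 < γ := by linarith
  have hgg : (Matrix.vecMulVec g.ofLp g.ofLp).PosSemidef := by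
    simpa using Matrix.posSemidef_vecMulVec_self_star g.ofLp
  obtain ⟨v, hv1, hv2, -⟩ :=
    exists_exponent_maximizer hγ hh (hP.add_posSemidef (hgg.smul hγ0.le)) (G + g)
  have hz : 0 < quad P⁻¹ g := quad_pos hP.inv hg0
  have hr : |⟪g, u⟫| ≤ rho γ := by
    refine (abs_real_inner_le_norm g u).trans ?_
    calc ‖g‖ * ‖u‖ ≤ h * (rho γ / h) := mul_le_mul hg hu (norm_nonneg _) hh.le
      _ = rho γ := by field_simp
  have h1 := quad_prod_bound (x := ⟪g, v⟫) hγ hr hz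
  have h2 := hmax v hv1
  have h3 := inner_sq_le_quad_mul_quad_inv hP (v - u) hg0
  rw [real_inner_comm, inner_sub_right] at h3
  rw [hv2, quad_matrix_add, quad_matrix_smul, quad_vecMulVec, inner_add_right,
    real_inner_comm g v]
  have h4 : (⟪g, v⟫ - ⟪g, u⟫) ^ 2 / (2 * quad P⁻¹ g) =
      1 / 2 * ((⟪g, v⟫ - ⟪g, u⟫) ^ 2 / quad P⁻¹ g) := by field_simp
  rw [h4] at h1
  linarith

/-- The potential is differentiable, and its tangent dominates it after a rank-one update. -/
theorem exists_gradient_potentialGen {ε σ γ h : ℝ} (hε : 0 < ε) (hσ : 0 < σ) (hγ : 1 < γ)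
    (hh : 0 < h) {V : Mat d} (hV : V.PosSemidef) (G : Vec d) :
    ∃ u : Vec d, HasGradientAt (fun G => potentialGen ε σ γ G V h) u G ∧
      ∀ g : Vec d, ‖g‖ ≤ h →
        potentialGen ε σ γ (G + g) (V + Matrix.vecMulVec g.ofLp g.ofLp) h ≤
          potentialGen ε σ γ G V h + ⟪g, u⟫ := by
  have hγ0 : 0 < γ := by linarith
  have hP := posDef_precision hσ hγ0 hV
  have hdet := det_one_add_smul_pos hσ hγ0 hV
  obtain ⟨u, hu, hval, hmax⟩ := exists_exponent_maximizer hγ hh hP G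
  have hgrad := hasGradientAt_exponent hγ hh hP hu hval hmax
  refine ⟨potentialGen ε σ γ G V h • u, ?_, fun g hg => ?_⟩
  · rw [hasGradientAt_iff_hasFDerivAt] at hgrad ⊢
    have h1 := (hgrad.exp.const_mul ε).mul_const (√((1 : Mat d) + (σ ^ 2 * γ) • V).det)⁻¹
    refine (h1.congr_fderiv ?_).congr_of_eventuallyEq ?_
    · ext x
      simp [potentialGen]
      ring
    · exact Filter.Eventually.of_forall fun x => by simp [potentialGen, div_eq_mul_inv]
  · rcases eq_or_ne g 0 with rfl | hg0
    · simp
    have hz : 0 < quad ((σ ^ 2)⁻¹ • (1 : Mat d) + γ • V)⁻¹ g := quad_pos hP.inv hg0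
    have hle := exponent_add_le hγ hh hP hu hmax hg hg0
    have hP' : (σ ^ 2)⁻¹ • (1 : Mat d) + γ • (V + Matrix.vecMulVec g.ofLp g.ofLp) =
        (σ ^ 2)⁻¹ • (1 : Mat d) + γ • V + γ • Matrix.vecMulVec g.ofLp g.ofLp := by
      rw [smul_add, add_assoc]
    have hdet' : ((1 : Mat d) + (σ ^ 2 * γ) • (V + Matrix.vecMulVec g.ofLp g.ofLp)).det =
        ((1 : Mat d) + (σ ^ 2 * γ) • V).det *
          (1 + γ * quad ((σ ^ 2)⁻¹ • (1 : Mat d) + γ • V)⁻¹ g) := by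
      rw [← sq_smul_precision γ hσ, ← sq_smul_precision γ hσ, Matrix.det_smul, Matrix.det_smul,
        hP', det_add_smul_vecMulVec hP, mul_assoc]
    have hr : 0 < 1 + ⟪g, u⟫ := by
      have h1 : |⟪g, u⟫| ≤ rho γ := by
        refine (abs_real_inner_le_norm g u).trans ?_
        calc ‖g‖ * ‖u‖ ≤ h * (rho γ / h) := mul_le_mul hg hu (norm_nonneg _) hh.le
          _ = rho γ := by field_simp
      linarith [(abs_le.1 h1).1, rho_lt_one hγ]
    set z := quad ((σ ^ 2)⁻¹ • (1 : Mat d) + γ • V)⁻¹ g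
    have hz1 : 0 < 1 + γ * z := by positivity
    have hexp := Real.exp_le_exp.2 hle
    have hsq : Real.exp (1 / 2 * Real.log (1 + γ * z)) = √(1 + γ * z) := by
      rw [one_div_mul_eq_div, ← Real.log_sqrt hz1.le, Real.exp_log (Real.sqrt_pos.2 hz1)]
    rw [Real.exp_add, Real.exp_add, hsq, Real.exp_log hr] at hexp
    have hs : 0 < √(1 + γ * z) := Real.sqrt_pos.2 hz1
    have hN : 0 < √((1 : Mat d) + (σ ^ 2 * γ) • V).det := Real.sqrt_pos.2 hdet
    simp only [potentialGen] at *
    rw [hP', hdet', Real.sqrt_mul hdet.le, inner_smul_right, div_le_iff₀ (by positivity)]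
    refine (mul_le_mul_of_nonneg_left hexp hε.le).trans (le_of_eq ?_)
    field_simp

theorem potentialGen_antitone {ε σ γ h k : ℝ} (hε : 0 < ε) (hσ : 0 < σ) (hγ : 1 < γ)
    (hh : 0 < h) (hk : h ≤ k) {V : Mat d} (hV : V.PosSemidef) (G : Vec d) :
    potentialGen ε σ γ G V k ≤ potentialGen ε σ γ G V h := by
  have := exponent_antitone hγ hh hk (posDef_precision hσ (by linarith : 0 < γ) hV) G
  unfold potentialGen
  gcongr

theorem potentialGen_zero {ε σ γ h : ℝ} (hσ : 0 < σ) (hγ : 1 < γ)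
    (hh : 0 < h) : potentialGen ε σ γ (0 : Vec d) 0 h = ε := by
  unfold potentialGen
  rw [exponent_zero hγ hh (posDef_precision hσ (by linarith : 0 < γ) Matrix.PosSemidef.zero)]
  simp

theorem hasGradientAt_potentialGen {ε σ γ : ℝ} (hε : 0 < ε) (hσ : 0 < σ) (hγ : 1 < γ)
    (g : ℕ → Vec d) (h : ℕ → ℝ) {t : ℕ} (hh : 0 < h t) :
    HasGradientAt (fun G : Vec d => potentialGen ε σ γ G (gradCov g (t - 1)) (h t))
      (-predictionGen ε σ γ g h t) (gradSum g (t - 1)) := by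
  obtain ⟨u, hu, -⟩ := exists_gradient_potentialGen hε hσ hγ hh (posSemidef_gradCov g (t - 1))
    (gradSum g (t - 1))
  rw [predictionGen, hu.gradient, neg_neg]
  exact hu

theorem inner_predictionGen_le {ε σ γ : ℝ} (hε : 0 < ε) (hσ : 0 < σ) (hγ : 1 < γ)
    (g : ℕ → Vec d) (h : ℕ → ℝ) {t : ℕ} (ht : 1 ≤ t) (hh : 0 < h t) (hg : ‖g t‖ ≤ h t) :
    ⟪g t, predictionGen ε σ γ g h t⟫ ≤
      potentialGen ε σ γ (gradSum g (t - 1)) (gradCov g (t - 1)) (h t)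
        - potentialGen ε σ γ (gradSum g t) (gradCov g t) (h t) := by
  obtain ⟨n, rfl⟩ : ∃ n, t = n + 1 := ⟨t - 1, by omega⟩
  obtain ⟨u, hu, hle⟩ := exists_gradient_potentialGen hε hσ hγ hh (posSemidef_gradCov g n)
    (gradSum g n)
  have h1 := hle _ hg
  simp only [predictionGen, Nat.add_sub_cancel]
  rw [hu.gradient, inner_neg_right, gradSum_succ, gradCov_succ]
  linarith

/-! ### The regret bound -/

theorem ValidHints.pos {g : ℕ → Vec d} {h : ℕ → ℝ} {T t : ℕ} (hv : ValidHints g h T)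
    (hpos : 0 < h 1) (ht : 1 ≤ t) (htT : t ≤ T) : 0 < h t :=
  hpos.trans_le (hv.1 ⟨le_rfl, ht.trans htT⟩ ⟨ht, htT⟩ ht)

theorem sum_inner_predictionGen_le {ε σ γ : ℝ} (hε : 0 < ε) (hσ : 0 < σ) (hγ : 1 < γ)
    {g : ℕ → Vec d} {h : ℕ → ℝ} (hpos : 0 < h 1) {T : ℕ} (hT : 1 ≤ T) (hv : ValidHints g h T) :
    ∑ t ∈ Finset.Icc 1 T, ⟪g t, predictionGen ε σ γ g h t⟫ ≤
      ε - potentialGen ε σ γ (gradSum g T) (gradCov g T) (h T) := by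
  have key : ∀ n, 1 ≤ n → n ≤ T → ∑ t ∈ Finset.Icc 1 n, ⟪g t, predictionGen ε σ γ g h t⟫ ≤
      ε - potentialGen ε σ γ (gradSum g n) (gradCov g n) (h n) := by
    intro n hn
    induction n, hn using Nat.le_induction with
    | base =>
      intro h1
      have := inner_predictionGen_le hε hσ hγ g h le_rfl hpos (hv.2 1 1 le_rfl le_rfl h1)
      have h0 : gradSum g 0 = 0 := by simp [gradSum]
      have h0' : gradCov g 0 = 0 := by simp [gradCov]
      rw [Nat.sub_self, h0, h0', potentialGen_zero hσ hγ hpos] at this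
      simpa using this
    | succ n hn ih =>
      intro h1
      rw [Finset.sum_Icc_succ_top (by omega)]
      have h2 := inner_predictionGen_le hε hσ hγ g h (t := n + 1) (by omega)
        (hv.pos hpos (by omega) h1) (hv.2 _ _ (by omega) le_rfl h1)
      -- The previous round ended with hint `h n`, the next decrease starts from `h (n + 1)`.
      have h3 := potentialGen_antitone hε hσ hγ (hv.pos hpos hn (by omega : n ≤ T))
        (hv.1 ⟨hn, by omega⟩ ⟨by omega, h1⟩ (by omega : n ≤ n + 1)) (posSemidef_gradCov g n)
        (gradSum g n)
      have h4 := ih (by omega)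
      rw [Nat.add_sub_cancel] at h2
      linarith
  exact key T hT le_rfl

/-- A bound on the convex conjugate of the potential. -/
theorem neg_inner_sub_potentialGen_le {ε σ γ h : ℝ} (hε : 0 < ε) (hσ : 0 < σ) (hγ : 1 < γ)
    (hh : 0 < h) {V : Mat d} (hV : V.PosSemidef) (G w : Vec d) {D Q : ℝ}
    (hD : D = ((1 : Mat d) + (σ ^ 2 * γ) • V).det / ε ^ 2)
    (hQ : Q = dirVar γ ((σ ^ 2)⁻¹ • (1 : Mat d) + γ • V) D h w) :
    -⟪w, G⟫ - potentialGen ε σ γ G V h ≤ √(Q * max 0 (Real.log (D * Q))) := by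
  have hγ0 : 0 < γ := by linarith
  have hP := posDef_precision hσ hγ0 hV
  have hdet := det_one_add_smul_pos hσ hγ0 hV
  have hρ := rho_pos hγ
  have hD0 : 0 < D := by rw [hD]; positivity
  have hsqD : √D = √((1 : Mat d) + (σ ^ 2 * γ) • V).det / ε := by
    rw [hD, Real.sqrt_div hdet.le, Real.sqrt_sq hε.le]
  have hsq0 : 0 < √D := Real.sqrt_pos.2 hD0
  have hpot : potentialGen ε σ γ G V h =
      Real.exp (exponent γ ((σ ^ 2)⁻¹ • (1 : Mat d) + γ • V) G h) / √D := by
    rw [hsqD, potentialGen]; field_simp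
  set P := (σ ^ 2)⁻¹ • (1 : Mat d) + γ • V
  have hb2 : (h * ‖w‖ / rho γ) ^ 2 = h ^ 2 * ‖w‖ ^ 2 / rho γ ^ 2 := by
    rw [div_pow, mul_pow]
  obtain ⟨η, hη, hbη, hle⟩ := exists_conjugate_bound (A := quad P w) (b := h * ‖w‖ / rho γ)
    (D := D) (Q := Q) (quad_nonneg hP.posSemidef w) (by positivity) hD0
    (by rw [hQ]; exact le_max_left _ _) (by rw [hQ, hb2]; exact le_max_right _ _)
  refine le_trans ?_ hle
  have hnorm : ‖-(η⁻¹ • w)‖ ≤ rho γ / h := by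
    rw [norm_neg, norm_smul, Real.norm_of_nonneg (by positivity), inv_mul_le_iff₀ hη]
    rw [div_le_iff₀ hρ] at hbη
    rw [mul_div_assoc', le_div_iff₀ hh]
    linarith
  have h1 := inner_sub_quad_le_exponent hγ hh hP G hnorm
  rw [inner_neg_left, real_inner_smul_left, quad_neg, quad_smul] at h1
  set f := exponent γ P G h
  have h2 : -⟪w, G⟫ ≤ η * f + quad P w / (2 * η) := by
    have h3 := mul_le_mul_of_nonneg_left h1 hη.le
    have h4 : η * (-(η⁻¹ * ⟪w, G⟫) - 1 / 2 * (η⁻¹ ^ 2 * quad P w)) =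
        -⟪w, G⟫ - quad P w / (2 * η) := by
      field_simp
    linarith
  -- Tangent of `exp` at `log (√D η)`, the point where the potential has slope `η` in `f`.
  have h5 : η * (1 + f - Real.log (√D * η)) ≤ potentialGen ε σ γ G V h := by
    rw [hpot]
    have h6 : Real.exp f / √D = η * Real.exp (f - Real.log (√D * η)) := by
      rw [Real.exp_sub, Real.exp_log (by positivity)]; field_simp
    rw [h6]
    gcongr
    linarith [Real.add_one_le_exp (f - Real.log (√D * η))]
  linarith

theorem regret_predictionGen_le {ε σ γ : ℝ} (hε : 0 < ε) (hσ : 0 < σ) (hγ : 1 < γ)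
    {g : ℕ → Vec d} {h : ℕ → ℝ} (hpos : 0 < h 1) {T : ℕ} (hT : 1 ≤ T) (hv : ValidHints g h T)
    (w : Vec d) {D Q : ℝ} (hD : D = (σ ^ 2 • (SigGen σ γ g T)⁻¹).det / ε ^ 2)
    (hQ : Q = dirVar γ (SigGen σ γ g T)⁻¹ D (h T) w) :
    ∑ t ∈ Finset.Icc 1 T, ⟪predictionGen ε σ γ g h t - w, g t⟫ ≤
      ε + √(Q * max 0 (Real.log (D * Q))) := by
  have hV := posSemidef_gradCov g T
  have hP := posDef_precision hσ (by linarith : 0 < γ) hV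
  rw [SigGen, Matrix.nonsing_inv_nonsing_inv _ hP.det_pos.ne'.isUnit] at hD hQ
  rw [sq_smul_precision γ hσ] at hD
  have h1 := neg_inner_sub_potentialGen_le hε hσ hγ (hv.pos hpos hT le_rfl) hV (gradSum g T) w
    hD hQ
  have h2 := sum_inner_predictionGen_le hε hσ hγ hpos hT hv
  have h3 : ∑ t ∈ Finset.Icc 1 T, ⟪predictionGen ε σ γ g h t - w, g t⟫ =
      ∑ t ∈ Finset.Icc 1 T, ⟪g t, predictionGen ε σ γ g h t⟫ - ⟪w, gradSum g T⟫ := by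
    rw [gradSum, inner_sum, ← Finset.sum_sub_distrib]
    refine Finset.sum_congr rfl fun t _ => ?_
    rw [inner_sub_left, real_inner_comm]
  rw [h3]
  linarith

/-! ### The tuned potential as a special case -/

theorem tuned_sq {γ h₁ : ℝ} (hγ : 0 < γ) : (√γ * h₁)⁻¹ ^ 2 = (γ * h₁ ^ 2)⁻¹ := by
  rw [inv_pow, mul_pow, Real.sq_sqrt hγ.le]

theorem potential_eq_potentialGen {γ h₁ : ℝ} (hγ : 0 < γ) :
    (potential γ h₁ : Vec d → Mat d → ℝ → ℝ) = potentialGen h₁ (√γ * h₁)⁻¹ γ := by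
  ext G V h
  have : (γ * h₁ ^ 2)⁻¹ * γ = 1 / h₁ ^ 2 := by field_simp
  rw [potential, potentialGen, tuned_sq hγ, inv_inv, this]

theorem prediction_eq_predictionGen {γ : ℝ} (hγ : 0 < γ) (g : ℕ → Vec d) (h : ℕ → ℝ) :
    prediction γ g h = predictionGen (h 1) (√γ * h 1)⁻¹ γ g h := by
  ext1 t
  rw [prediction, predictionGen, potential_eq_potentialGen hγ]

theorem Sig_eq_SigGen {γ h₁ : ℝ} (hγ : 0 < γ) (g : ℕ → Vec d) (T : ℕ) :
    Sig γ h₁ g T = SigGen (√γ * h₁)⁻¹ γ g T := by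
  rw [Sig, SigGen, tuned_sq hγ, inv_inv]

/-- Reconciles the two ways the determinant factor is written; the conventions for inverses make it
hold even for singular `S` or `c = 0`. -/
theorem det_smul_inv_eq {c : ℝ} (S : Mat d) : ((c • S).det)⁻¹ = (c⁻¹ • S⁻¹).det := by
  rw [Matrix.det_smul, Matrix.det_smul, mul_inv, inv_pow, Matrix.det_nonsing_inv,
    Ring.inverse_eq_inv']

end MatrixFreeGrad

open MatrixFreeGrad in
open scoped RealInnerProductSpace in
theorem theorem4 {d : ℕ} (γ : ℝ) (hγ : 1 < γ) (g : ℕ → Vec d) (h : ℕ → ℝ) (hpos : 0 < h 1) :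
    -- Matrix-FreeGrad: well-definedness of the prediction, potential decrease, regret bound
    ((∀ t, 1 ≤ t → 0 < h t →
        HasGradientAt (fun G : Vec d => potential γ (h 1) G (gradCov g (t - 1)) (h t))
          (-prediction γ g h t) (gradSum g (t - 1))) ∧
      (∀ t, 1 ≤ t → 0 < h t → ‖g t‖ ≤ h t →
        ⟪g t, prediction γ g h t⟫ ≤
          potential γ (h 1) (gradSum g (t - 1)) (gradCov g (t - 1)) (h t)
            - potential γ (h 1) (gradSum g t) (gradCov g t) (h t)) ∧
      (∀ T, 1 ≤ T → ValidHints g h T → ∀ w : Vec d,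
        let S : Mat d := Sig γ (h 1) g T
        let D : ℝ := ((γ * h 1 ^ 2) • S).det⁻¹ / h 1 ^ 2
        let Q : ℝ := dirVar γ S⁻¹ D (h T) w
        ∑ t ∈ Finset.Icc 1 T, ⟪prediction γ g h t - w, g t⟫ ≤
          h 1 + √(Q * max 0 (Real.log (D * Q))))) ∧
    -- the same for the potential with general prior variance and initial wealth
    (∀ ε σ : ℝ, 0 < ε → 0 < σ →
      (∀ t, 1 ≤ t → 0 < h t →
        HasGradientAt (fun G : Vec d => potentialGen ε σ γ G (gradCov g (t - 1)) (h t))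
          (-predictionGen ε σ γ g h t) (gradSum g (t - 1))) ∧
      (∀ t, 1 ≤ t → 0 < h t → ‖g t‖ ≤ h t →
        ⟪g t, predictionGen ε σ γ g h t⟫ ≤
          potentialGen ε σ γ (gradSum g (t - 1)) (gradCov g (t - 1)) (h t)
            - potentialGen ε σ γ (gradSum g t) (gradCov g t) (h t)) ∧
      (∀ T, 1 ≤ T → ValidHints g h T → ∀ w : Vec d,
        let S : Mat d := SigGen σ γ g T
        let D : ℝ := (σ ^ 2 • S⁻¹).det / ε ^ 2
        let Q : ℝ := dirVar γ S⁻¹ D (h T) w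
        ∑ t ∈ Finset.Icc 1 T, ⟪predictionGen ε σ γ g h t - w, g t⟫ ≤
          ε + √(Q * max 0 (Real.log (D * Q))))) := by
  have hγ0 : 0 < γ := by linarith
  refine ⟨?_, fun ε σ hε hσ => ⟨fun t _ ht => hasGradientAt_potentialGen hε hσ hγ g h ht,
    fun t h1 ht hg => inner_predictionGen_le hε hσ hγ g h h1 ht hg,
    fun T hT hv w => regret_predictionGen_le hε hσ hγ hpos hT hv w rfl rfl⟩⟩
  have hσ : 0 < (√γ * h 1)⁻¹ := by positivity
  rw [prediction_eq_predictionGen hγ0, potential_eq_potentialGen hγ0]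
  refine ⟨fun t _ ht => hasGradientAt_potentialGen hpos hσ hγ g h ht,
    fun t h1 ht hg => inner_predictionGen_le hpos hσ hγ g h h1 ht hg, fun T hT hv w => ?_⟩
  simp only [Sig_eq_SigGen hγ0, det_smul_inv_eq, ← tuned_sq hγ0]
  exact regret_predictionGen_le hpos hσ hγ hpos hT hv w rfl rfl
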